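/- Let $K$ be a field, let $t$ be transcendental over $K$, and fix a separable closure $K(t)^{\mathrm{sep}}$ of $K(t)$. Let $f\in K[x]$ be a polynomial whose degree $d\ge 1$ is not divisible by the characteristic of $K$ (this holds whenever the extension of rational function fields given by $f(x)=t$ is tamely ramified, since $f$ is totally ramified over $\infty$). Let $f^{-\infty}(t)\subseteq K(t)^{\mathrm{sep}}$ be the set of all $x$ with $f^n(x)=t$ for some $n\ge 0$, where $f^n$ is the $n$-th iterate, and let the constant field extension $\widehat K_f$ be the algebraic closure of $K$ in $K(f^{-\infty}(t))$. Then: 1. $\widehat K_f/K$ is small: it is a Galois extension, and for every integer $n\ge 1$ the group $\mathrm{Gal}(\widehat K_f/K)$ has only finitely many subgroups of index $n$. 2. $\widehat K_f$ is contained in the pro-$d$ cyclotomic extension $K(\zeta_{d^\infty})$ of $K$, the extension generated by all $\zeta\in K(t)^{\mathrm{sep}}$ with $\zeta^{d^n}=1$ for some $n\ge 0$. 3. $\mathrm{Gal}(\widehat K_f/K)$, with its Krull topology, is topologically finitely generated. -/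

import Mathlib

open scoped Polynomial

noncomputable section

/-- `K(t)^sep`: a fixed separable closure of the rational function field `K(t)`. -/
abbrev SepClosureRatFunc (K : Type*) [Field K] : Type _ := SeparableClosure (RatFunc K)

/-- The set `f^{-∞}(t)` of all preimages of `t` under the iterates `f^n`, `n ≥ 0`,
inside `K(t)^sep` (it contains `t` itself). -/
def iteratedPreimages {K : Type*} [Field K] (f : K[X]) : Set (SepClosureRatFunc K) :=
  {x | ∃ n : ℕ, (fun y : SepClosureRatFunc K => Polynomial.aeval y f)^[n] x =
    algebraMap (RatFunc K) (SepClosureRatFunc K) RatFunc.X}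

/-- The field `K(f^{-∞}(t))`, as an extension of `K(t)`. -/
def iteratedPreimageField {K : Type*} [Field K] (f : K[X]) :
    IntermediateField (RatFunc K) (SepClosureRatFunc K) :=
  IntermediateField.adjoin (RatFunc K) (iteratedPreimages f)

/-- The constant field extension `K̂_f` of `K`: the algebraic closure of `K` in
`K(f^{-∞}(t))`. -/
def constantField {K : Type*} [Field K] (f : K[X]) :
    IntermediateField K (SepClosureRatFunc K) :=
  algebraicClosure K (SepClosureRatFunc K) ⊓ (iteratedPreimageField f).restrictScalars K

/-- The pro-`d` cyclotomic extension `K(ζ_{d^∞})` of `K` inside an extension field `Ω`: it is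
generated by all roots of unity in `Ω` whose order divides a power of `d`. -/
def proCyclotomicField (K Ω : Type*) [Field K] [Field Ω] [Algebra K Ω] (d : ℕ) :
    IntermediateField K Ω :=
  IntermediateField.adjoin K {ζ : Ω | ∃ n : ℕ, ζ ^ d ^ n = 1}

/-- A topological group is topologically finitely generated if some finite subset generates
a dense subgroup. -/
def IsTopologicallyFG (G : Type*) [Group G] [TopologicalSpace G] [IsTopologicalGroup G] : Prop :=
  ∃ S : Finset G, (Subgroup.closure (S : Set G)).topologicalClosure = ⊤

/-- A Galois extension `L/K` is small if, for each positive integer `n`, its Galois group has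
only finitely many subgroups of index `n`. -/
structure IsSmallExtension (K L : Type*) [Field K] [Field L] [Algebra K L] : Prop where
  isGalois : IsGalois K L
  finite_index_eq : ∀ n : ℕ, 0 < n → {H : Subgroup (L ≃ₐ[K] L) | H.index = n}.Finite

end

/-! Near infinity, the iterated preimages of t are Laurent series over the cyclotomic field P =
K(ζ_{d^∞}). For F = f^N put t = F(1/s). Every solution y of F(y) = F(1/s) lies in P((s)): u = sy
satisfies an integral equation reducing to u^(d^N) = 1 modulo s, and Hensel's lemma applies because
d^N is nonzero in K and P contains the roots of unity. Hence K(f^{-N}(t)) embeds in P((s)), whose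
elements algebraic over P are constants, so the constant field lies in P
(`constantField_le_proCyclotomicField`).

P/K is abelian, so the constant field is abelian over K and its group is a quotient of Gal(P/K). The
cyclotomic character describes Gal(P/K) by d-adic digits. The digit groups ascend in ℤ, hence
stabilize, so one automorphism together with finitely many coset representatives generates a dense
subgroup (`exists_pow_mul_actsAsPow_one`). For a compact abelian group G, topological finite
generation makes G/G^n finite, which bounds the subgroups of index n, closed or not. -/

/-! ### Constants and solutions of p(y) = p(1/s) in Laurent series -/

open scoped PowerSeries LaurentSeries

/-- The constants are algebraically closed in the field of Laurent series. -/
theorem LaurentSeries.exists_C_eq_of_isIntegralElem {L : Type*} [Field L] {x : L⸨X⸩}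
    (hx : (HahnSeries.C : L →+* L⸨X⸩).IsIntegralElem x) : ∃ c : L, HahnSeries.C c = x := by
  let : Algebra L L⸨X⸩ := (HahnSeries.C : L →+* L⸨X⸩).toAlgebra
  have hcomp : (algebraMap L⟦X⟧ L⸨X⸩).comp PowerSeries.C = HahnSeries.C :=
    RingHom.ext fun c => HahnSeries.ofPowerSeries_C c
  have key : ∀ y : L⸨X⸩, IsAlgebraic L y → ∃ p : L⟦X⟧, HahnSeries.ofPowerSeries ℤ L p = y := by
    intro y hy
    obtain ⟨p, hp, hpy⟩ := hy.isIntegral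
    refine (IsIntegrallyClosed.isIntegral_iff (R := L⟦X⟧)).1 ⟨p.map PowerSeries.C, hp.map _, ?_⟩
    rw [Polynomial.eval₂_map, hcomp]
    exact hpy
  replace hx : IsAlgebraic L x := IsIntegral.isAlgebraic hx
  obtain ⟨p, rfl⟩ := key x hx
  set c := PowerSeries.constantCoeff p with hc
  refine ⟨c, ?_⟩
  have halg : IsAlgebraic L (HahnSeries.ofPowerSeries ℤ L (p - PowerSeries.C c)) := by
    rw [map_sub]
    refine hx.sub ?_
    rw [HahnSeries.ofPowerSeries_C]
    exact isAlgebraic_algebraMap (A := L⸨X⸩) c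
  by_cases h0 : HahnSeries.ofPowerSeries ℤ L (p - PowerSeries.C c) = 0
  · rw [map_sub, sub_eq_zero, HahnSeries.ofPowerSeries_C] at h0
    exact h0.symm
  -- The inverse is algebraic too, hence a power series, which would make a series with zero
  -- constant term a unit.
  · obtain ⟨r, hr⟩ := key _ halg.inv
    have h1 : (p - PowerSeries.C c) * r = 1 := by
      apply HahnSeries.ofPowerSeries_injective (Γ := ℤ)
      rw [map_mul, hr, mul_inv_cancel₀ h0, map_one]
    have h2 := congrArg PowerSeries.constantCoeff h1
    simp [hc] at h2

theorem LaurentSeries.eval₂_C_single_neg_one_injective (L : Type*) [Field L] :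
    Function.Injective (Polynomial.eval₂RingHom (HahnSeries.C : L →+* L⸨X⸩)
      (HahnSeries.single (-1 : ℤ) (1 : L))) := by
  rw [injective_iff_map_eq_zero]
  intro p hp
  by_contra hp0
  let : Algebra L L⸨X⸩ := (HahnSeries.C : L →+* L⸨X⸩).toAlgebra
  have halg : IsAlgebraic L (HahnSeries.single (-1 : ℤ) (1 : L)) := ⟨p, hp0, hp⟩
  obtain ⟨c, hc⟩ := exists_C_eq_of_isIntegralElem halg.isIntegral
  have := congrArg (fun y : L⸨X⸩ => y.coeff (-1)) hc
  simp [HahnSeries.C_apply] at this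

open Polynomial in
/-- A monic polynomial over `L⟦X⟧` whose reduction is `u ^ n - 1`, where `L` contains a primitive
`n`-th root of unity and `n ≠ 0` in `L`, is a product of linear factors. -/
theorem Polynomial.prod_X_sub_C_of_map_constantCoeff_eq {L : Type*} [Field L] {n : ℕ}
    (hn : (n : L) ≠ 0) {ζ : L} (hζ : IsPrimitiveRoot ζ n) {G : L⟦X⟧[X]} (hG : G.Monic)
    (hmap : G.map (PowerSeries.constantCoeff (R := L)) = X ^ n - 1) :
    (G.roots.map fun a => X - C a).prod = G := by
  classical
  have hn0 : n ≠ 0 := by rintro rfl; simp at hn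
  have hdeg : G.natDegree = n := by
    rw [← hG.natDegree_map (PowerSeries.constantCoeff (R := L)), hmap, ← map_one C,
      natDegree_X_pow_sub_C]
  refine prod_multiset_X_sub_C_of_monic_of_roots_card_eq hG (le_antisymm (card_roots' G) ?_)
  -- Each root of unity ξ is a simple root of the reduction, with derivative nξ^(n-1), and lifts by
  -- Hensel; distinct residues give n distinct roots.
  have hsub : nthRootsFinset n (1 : L) ⊆
      G.roots.toFinset.image (PowerSeries.constantCoeff (R := L)) := by
    intro ξ hξ
    rw [mem_nthRootsFinset (Nat.pos_of_ne_zero hn0)] at hξ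
    have hev : ∀ (q : L⟦X⟧[X]), PowerSeries.constantCoeff (q.eval (PowerSeries.C ξ)) =
        (q.map (PowerSeries.constantCoeff (R := L))).eval ξ := by
      intro q
      rw [eval_map, eval, hom_eval₂]
      simp
    obtain ⟨a, ha, hsuba⟩ := HenselianRing.is_henselian (I := Ideal.span {(PowerSeries.X : L⟦X⟧)})
      G hG (PowerSeries.C ξ)
      (by rw [Ideal.mem_span_singleton, PowerSeries.X_dvd_iff, hev, hmap]; simp [hξ])
      (by
        apply IsUnit.map
        rw [PowerSeries.isUnit_iff_constantCoeff, hev, ← derivative_map, hmap]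
        have : ξ ≠ 0 := by rintro rfl; simp [hn0] at hξ
        rw [derivative_sub, derivative_X_pow]
        simp [hn, this])
    rw [Finset.mem_image]
    refine ⟨a, by simpa [hG.ne_zero] using ha, ?_⟩
    rw [Ideal.mem_span_singleton, PowerSeries.X_dvd_iff, map_sub, sub_eq_zero] at hsuba
    simpa using hsuba
  calc G.natDegree = (nthRootsFinset n (1 : L)).card := by rw [hdeg, hζ.card_nthRootsFinset]
    _ ≤ _ := Finset.card_le_card hsub
    _ ≤ _ := Finset.card_image_le
    _ ≤ _ := Multiset.toFinset_card_le _

open Polynomial in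
/-- If `L` contains the roots of unity of order `deg p`, all solutions `y` of `p(y) = p(1/s)` are
Laurent series in `s`. -/
theorem LaurentSeries.mem_range_of_monic_of_eval₂_eq {L E : Type*} [Field L] [Field E]
    (j : L⸨X⸩ →+* E) {p : L[X]} (hp : p.Monic) (hn : (p.natDegree : L) ≠ 0) {ζ : L}
    (hζ : IsPrimitiveRoot ζ p.natDegree) {y : E}
    (hy : p.eval₂ (j.comp HahnSeries.C) y =
      j (p.eval₂ HahnSeries.C (HahnSeries.single (-1 : ℤ) (1 : L)))) : y ∈ j.range := by
  set s : L⟦X⟧ := PowerSeries.X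
  set φ : L⟦X⟧ →+* L⸨X⸩ := HahnSeries.ofPowerSeries ℤ L with hφ
  have hφs : φ s * HahnSeries.single (-1 : ℤ) (1 : L) = 1 := by
    simp [hφ, s, HahnSeries.ofPowerSeries_X]
  have hφC : φ.comp PowerSeries.C = HahnSeries.C := by
    ext1 c; simp [hφ, HahnSeries.ofPowerSeries_C]
  have hs0 : j (φ s) ≠ 0 := by
    intro h
    have := congrArg j hφs
    simp [h] at this
  set q : L⟦X⟧[X] := p.map PowerSeries.C with hq
  have hqm : q.Monic := hp.map _
  have hqd : q.natDegree = p.natDegree := hp.natDegree_map _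
  -- With n = deg p, G(sY) = s^n (p(Y) - p(1/s)), and G has power series coefficients.
  set G : L⟦X⟧[X] := q.scaleRoots s - C ((q.scaleRoots s).eval 1) with hGdef
  have hd0 : p.natDegree ≠ 0 := by rintro h; simp [h] at hn
  have hGm : G.Monic := by
    refine Monic.sub_of_left ((monic_scaleRoots_iff s).2 hqm) (degree_C_le.trans_lt ?_)
    rw [degree_scaleRoots, ← natDegree_pos_iff_degree_pos, hqd]
    exact Nat.pos_of_ne_zero hd0
  have hred : (q.scaleRoots s).map (PowerSeries.constantCoeff (R := L)) = X ^ p.natDegree := by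
    rw [map_scaleRoots _ _ _ (by simp [hqm.leadingCoeff])]
    have : PowerSeries.constantCoeff s = (0 : L) := by simp [s]
    rw [this, scaleRoots_zero, (hqm.map _).leadingCoeff, one_smul, hqm.natDegree_map, hqd]
  have hGred : G.map (PowerSeries.constantCoeff (R := L)) = X ^ p.natDegree - 1 := by
    rw [hGdef, Polynomial.map_sub, hred, map_C, ← eval₂_id, hom_eval₂, ← eval_map,
      RingHom.comp_id, hred]
    simp
  have hsplit := prod_X_sub_C_of_map_constantCoeff_eq hn hζ hGm hGred
  have hroot : G.eval₂ (j.comp φ) (j (φ s) * y) = 0 := by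
    have h1 := scaleRoots_eval₂_mul (p := q) (j.comp φ) y s
    have h2 := scaleRoots_eval₂_mul (p := q) φ (HahnSeries.single (-1 : ℤ) (1 : L)) s
    rw [hφs] at h2
    have h3 : (j.comp φ) ((q.scaleRoots s).eval 1) =
        j ((q.scaleRoots s).eval₂ φ 1) := by
      rw [← eval₂_id, hom_eval₂, hom_eval₂]; simp
    rw [hGdef, eval₂_sub, eval₂_C, h3, h2]
    rw [RingHom.comp_apply] at h1
    rw [h1, hq, eval₂_map, eval₂_map, RingHom.comp_assoc, hφC, hy, map_mul, map_pow, sub_self]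
  rw [← hsplit, eval₂_multiset_prod, Multiset.prod_eq_zero_iff] at hroot
  simp only [Multiset.map_map, Multiset.mem_map, Function.comp_apply] at hroot
  obtain ⟨a, -, ha⟩ := hroot
  rw [eval₂_sub, eval₂_X, eval₂_C, sub_eq_zero] at ha
  refine ⟨φ a / φ s, ?_⟩
  rw [map_div₀, div_eq_iff hs0, mul_comm, ha, RingHom.comp_apply]

/-! ### The constant field lies in the cyclotomic field -/

/-- Two embeddings of a normal extension that agree on the base have the same image. This moves a
constant of P((s)) back into the copy of P inside K(t)^sep. -/
theorem exists_apply_eq_apply_of_normal {K P E : Type*} [Field K] [Field P] [Field E] [Algebra K P]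
    [Normal K P] (ψ₁ ψ₂ : P →+* E)
    (h : ψ₁.comp (algebraMap K P) = ψ₂.comp (algebraMap K P)) (c : P) :
    ∃ c', ψ₂ c' = ψ₁ c := by
  let : Algebra K E := (ψ₂.comp (algebraMap K P)).toAlgebra
  let : Algebra P E := ψ₂.toAlgebra
  have : IsScalarTower K P E := .of_algebraMap_eq fun _ => rfl
  let χ : P →ₐ[K] E := { ψ₁ with commutes' := fun x => RingHom.congr_fun h x }
  exact ⟨χ.restrictNormal P c, χ.restrictNormal_commutes P c⟩

theorem isCyclotomicExtension_proCyclotomicField (K Ω : Type*) [Field K] [Field Ω] [Algebra K Ω]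
    [IsSepClosed Ω] {d : ℕ} (hd : (d : K) ≠ 0) :
    IsCyclotomicExtension (Set.range fun n : ℕ => d ^ n) K (proCyclotomicField K Ω d) := by
  have hd0 : d ≠ 0 := by rintro rfl; simp at hd
  have hset : {ζ : Ω | ∃ n : ℕ, ζ ^ d ^ n = 1} =
      {b : Ω | ∃ n ∈ Set.range fun n : ℕ => d ^ n, n ≠ 0 ∧ b ^ n = 1} := by
    ext b
    simp [hd0]
  rw [proCyclotomicField, hset]
  refine IntermediateField.isCyclotomicExtension_adjoin_of_exists_isPrimitiveRoot _ K Ω ?_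
  rintro _ ⟨n, rfl⟩ -
  have hdΩ : (d : Ω) ≠ 0 := by
    rwa [← map_natCast (algebraMap K Ω), map_ne_zero]
  have : NeZero ((d ^ n : ℕ) : Ω) := ⟨by simpa using fun h => absurd h hdΩ⟩
  exact HasEnoughRootsOfUnity.exists_primitiveRoot Ω (d ^ n)

theorem exists_mem_adjoin_iteratedPreimages_le {K : Type*} [Field K] (f : K[X])
    {α : SepClosureRatFunc K} (hα : α ∈ iteratedPreimageField f) :
    ∃ N : ℕ, α ∈ IntermediateField.adjoin (RatFunc K) {x : SepClosureRatFunc K |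
      ∃ n ≤ N, (fun y : SepClosureRatFunc K => Polynomial.aeval y f)^[n] x =
        algebraMap (RatFunc K) (SepClosureRatFunc K) RatFunc.X} := by
  obtain ⟨T, hT, hα⟩ := IntermediateField.exists_finset_of_mem_adjoin hα
  have hex : ∀ x ∈ T, ∃ n : ℕ, (fun y : SepClosureRatFunc K => Polynomial.aeval y f)^[n] x =
      algebraMap (RatFunc K) (SepClosureRatFunc K) RatFunc.X := fun x hx => hT hx
  choose! n hn using hex
  refine ⟨T.sup n, IntermediateField.adjoin.mono _ _ _ (fun x hx => ?_) hα⟩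
  exact ⟨n x, Finset.le_sup (f := n) hx, hn x hx⟩

/-- The function field `K(t)` embeds into the field of Laurent series in `s` by `t ↦ F(1/s)`. -/
theorem exists_ratFunc_ringHom_laurentSeries {K L : Type*} [Field K] [Field L] [Algebra K L]
    {F : K[X]} (hF : F.natDegree ≠ 0) :
    ∃ θ : RatFunc K →+* L⸨X⸩,
      (∀ c : K, θ (algebraMap K (RatFunc K) c) = HahnSeries.C (algebraMap K L c)) ∧
      θ RatFunc.X = F.eval₂ ((HahnSeries.C : L →+* L⸨X⸩).comp (algebraMap K L))
        (HahnSeries.single (-1 : ℤ) (1 : L)) := by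
  set κ : K →+* L⸨X⸩ := HahnSeries.C.comp (algebraMap K L)
  set y : L⸨X⸩ := HahnSeries.single (-1 : ℤ) (1 : L) with hy
  have hinj : Function.Injective (Polynomial.eval₂RingHom κ (F.eval₂ κ y)) := by
    rw [injective_iff_map_eq_zero]
    intro p hp
    rw [Polynomial.coe_eval₂RingHom, ← Polynomial.eval₂_comp, ← Polynomial.eval₂_map] at hp
    have := (injective_iff_map_eq_zero _).1 (LaurentSeries.eval₂_C_single_neg_one_injective L) _ hp
    rw [Polynomial.map_eq_zero_iff (algebraMap K L).injective, Polynomial.comp_eq_zero_iff] at this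
    refine this.resolve_right fun h => hF ?_
    rw [h.2, Polynomial.natDegree_C]
  refine ⟨IsFractionRing.lift hinj, fun c => ?_, ?_⟩
  · rw [IsScalarTower.algebraMap_apply K K[X] (RatFunc K), IsFractionRing.lift_algebraMap]
    simp [κ]
  · rw [← RatFunc.algebraMap_X, IsFractionRing.lift_algebraMap]
    simp

theorem LaurentSeries.mem_range_of_eval₂_eq {K L E : Type*} [Field K] [Field L] [Algebra K L]
    [Field E] (j : L⸨X⸩ →+* E) {F : K[X]} (hn : (F.natDegree : K) ≠ 0) {ζ : L}
    (hζ : IsPrimitiveRoot ζ F.natDegree) {y : E}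
    (hy : F.eval₂ (j.comp (HahnSeries.C.comp (algebraMap K L))) y =
      j (F.eval₂ (HahnSeries.C.comp (algebraMap K L)) (HahnSeries.single (-1 : ℤ) (1 : L)))) :
    y ∈ j.range := by
  have hF : F ≠ 0 := by rintro rfl; simp at hn
  set p : L[X] := (F * Polynomial.C F.leadingCoeff⁻¹).map (algebraMap K L)
  have hpm : p.Monic := (Polynomial.monic_mul_leadingCoeff_inv hF).map _
  have hpd : p.natDegree = F.natDegree := by
    rw [Polynomial.natDegree_map, Polynomial.natDegree_mul_leadingCoeff_inv _ hF]
  refine mem_range_of_monic_of_eval₂_eq j hpm (ζ := ζ) ?_ (by rwa [hpd]) ?_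
  · rwa [hpd, ← map_natCast (algebraMap K L), map_ne_zero]
  · rw [Polynomial.eval₂_map, Polynomial.eval₂_map, RingHom.comp_assoc, Polynomial.eval₂_mul,
      Polynomial.eval₂_mul, hy, map_mul, Polynomial.eval₂_C, Polynomial.eval₂_C]
    rfl

theorem constantField_le_proCyclotomicField {K : Type*} [Field K] (f : K[X])
    (hf : (f.natDegree : K) ≠ 0) :
    constantField f ≤ proCyclotomicField K (SepClosureRatFunc K) f.natDegree := by
  rintro α ⟨hαalg, hα⟩
  obtain ⟨N, hαN⟩ := exists_mem_adjoin_iteratedPreimages_le f hα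
  clear hα
  set P := proCyclotomicField K (SepClosureRatFunc K) f.natDegree with hP
  have hcyc :=
    isCyclotomicExtension_proCyclotomicField K (SepClosureRatFunc K) hf
  rw [← hP] at hcyc
  have hgal : IsAbelianGalois K P := 
    IsCyclotomicExtension.isAbelianGalois (Set.range fun n : ℕ => f.natDegree ^ n) K P
  have hd0 : f.natDegree ≠ 0 := by intro h; simp [h] at hf
  set F : K[X] := f.comp^[N] Polynomial.X with hF
  have hFd : F.natDegree = f.natDegree ^ N := by
    rw [hF, Polynomial.natDegree_iterate_comp, Polynomial.natDegree_X, mul_one]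
  obtain ⟨ζ, hζ⟩ := hcyc.exists_isPrimitiveRoot
    (n := f.natDegree ^ N) ⟨N, rfl⟩ (pow_ne_zero N hd0)
  obtain ⟨θ, hθC, hθX⟩ := exists_ratFunc_ringHom_laurentSeries (K := K) (L := P) (F := F)
    (by rw [hFd]; exact pow_ne_zero N hd0)
  let E := AlgebraicClosure P⸨X⸩
  let j : P⸨X⸩ →+* E := algebraMap P⸨X⸩ E
  let : Algebra (RatFunc K) E := (j.comp θ).toAlgebra
  let φ : SepClosureRatFunc K →ₐ[RatFunc K] E := IsAlgClosed.lift
  set κ₀ : K →+* P⸨X⸩ := HahnSeries.C.comp (algebraMap K P) with hκ₀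
  set κ : K →+* E := j.comp κ₀ with hκ
  have hφθ : ∀ r, φ (algebraMap (RatFunc K) _ r) = j (θ r) := fun r => φ.commutes r
  have hφK : (φ : SepClosureRatFunc K →+* E).comp (algebraMap K _) = κ := by
    ext c
    rw [RingHom.comp_apply, IsScalarTower.algebraMap_apply K (RatFunc K) (SepClosureRatFunc K)]
    exact (hφθ _).trans (congrArg j (hθC c))
  have hsemiφ : Function.Semiconj φ (fun y => Polynomial.aeval y f) (fun y => f.eval₂ κ y) := by
    intro y
    rw [← hφK]
    exact Polynomial.hom_eval₂ f (algebraMap K _) (φ : SepClosureRatFunc K →+* E) y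
  have hsemij : Function.Semiconj j (fun y => f.eval₂ κ₀ y) (fun y => f.eval₂ κ y) :=
    fun y => Polynomial.hom_eval₂ f κ₀ j y
  have hsurj : Function.Surjective fun y => f.eval₂ κ y := by
    intro b
    obtain ⟨z, hz⟩ := IsAlgClosed.exists_root (f.map κ - Polynomial.C b) (by
      rw [Polynomial.degree_sub_C, Polynomial.degree_map]
      · exact (Polynomial.natDegree_pos_iff_degree_pos.1 (Nat.pos_of_ne_zero hd0)).ne'
      · rw [Polynomial.degree_map]
        exact Polynomial.natDegree_pos_iff_degree_pos.1 (Nat.pos_of_ne_zero hd0))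
    refine ⟨z, ?_⟩
    simpa [Polynomial.IsRoot, Polynomial.eval_map, sub_eq_zero] using hz
  have hmem : ∀ x : SepClosureRatFunc K, ∀ n ≤ N,
      (fun y : SepClosureRatFunc K => Polynomial.aeval y f)^[n] x =
        algebraMap (RatFunc K) (SepClosureRatFunc K) RatFunc.X → φ x ∈ j.range := by
    intro x n hn hx
    -- A preimage at level n ≤ N is f^(N-n) of a solution z of F(z) = F(1/s), so only level N needs
    -- Hensel.
    obtain ⟨z, hz⟩ := hsurj.iterate (N - n) (φ x)
    have hzF : F.eval₂ κ z = j (F.eval₂ κ₀ (HahnSeries.single (-1 : ℤ) (1 : P))) := by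
      rw [hF, Polynomial.iterate_comp_eval₂, Polynomial.eval₂_X, ← Nat.add_sub_cancel' hn,
        Function.iterate_add_apply, hz, ← hsemiφ.iterate_right n x, hx, hφθ, hθX,
        Nat.add_sub_cancel' hn]
    obtain ⟨w, rfl⟩ := LaurentSeries.mem_range_of_eval₂_eq j (F := F) (ζ := ζ)
      (by rw [hFd]; simpa using fun h => absurd h hf) (by rwa [hFd]) hzF
    refine ⟨_, (hsemij.iterate_right (N - n) w).trans hz⟩
  have hφα : φ α ∈ j.range := by
    refine IntermediateField.adjoin_induction (RatFunc K)
      (p := fun x _ => φ x ∈ j.fieldRange) ?_ ?_ ?_ ?_ ?_ hαN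
    · rintro x ⟨n, hn, hx⟩
      exact hmem x n hn hx
    · exact fun r => ⟨θ r, (hφθ r).symm⟩
    · intro x y _ _ hx hy
      rw [map_add]
      exact add_mem hx hy
    · intro x _ hx
      rw [map_inv₀]
      exact inv_mem hx
    · intro x y _ _ hx hy
      rw [map_mul]
      exact mul_mem hx hy
  obtain ⟨β, hβ⟩ := hφα
  have hint : IsIntegral K α := (mem_algebraicClosure_iff.1 hαalg).isIntegral
  have hβint : (HahnSeries.C : P →+* P⸨X⸩).IsIntegralElem β := by
    refine ⟨(minpoly K α).map (algebraMap K P), (minpoly.monic hint).map _, ?_⟩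
    rw [Polynomial.eval₂_map]
    apply j.injective
    rw [Polynomial.hom_eval₂, ← hκ₀, ← hκ, hβ, ← hφK, map_zero]
    have := Polynomial.hom_eval₂ (minpoly K α) (algebraMap K _) (φ : SepClosureRatFunc K →+* E) α
    rw [← Polynomial.aeval_def, minpoly.aeval, map_zero] at this
    exact this.symm
  obtain ⟨c, rfl⟩ := LaurentSeries.exists_C_eq_of_isIntegralElem hβint
  obtain ⟨c', hc'⟩ := exists_apply_eq_apply_of_normal (K := K) (j.comp HahnSeries.C)
    ((φ : SepClosureRatFunc K →+* E).comp (algebraMap P (SepClosureRatFunc K)))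
    (by rw [RingHom.comp_assoc, RingHom.comp_assoc, ← hκ₀, ← hκ, ← hφK]; rfl) c
  have : φ (c' : SepClosureRatFunc K) = φ α := hc'.trans hβ
  rw [← φ.injective this]
  exact c'.2

/-! ### Cyclotomic character and congruences -/

/-- `σ` acts on the `m`-th roots of unity of `L` by `ζ ↦ ζ ^ a`. -/
def ActsAsPow {K L : Type*} [Field K] [Field L] [Algebra K L] (m : ℕ) (σ : L ≃ₐ[K] L) (a : ℤ) :
    Prop :=
  ∀ ζ : L, ζ ^ m = 1 → σ ζ = ζ ^ a

theorem zpow_eq_zpow_of_modEq {L : Type*} [Field L] {m : ℕ} (hm : m ≠ 0) {ζ : L} (hζ : ζ ^ m = 1)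
    {a b : ℤ} (h : a ≡ b [ZMOD m]) : ζ ^ a = ζ ^ b := by
  obtain ⟨c, hc⟩ := h.dvd
  have hζ0 : ζ ≠ 0 := by rintro rfl; simp [hm] at hζ
  rw [← sub_add_cancel b a, zpow_add₀ hζ0, hc, zpow_mul, zpow_natCast, hζ, one_zpow, one_mul]

namespace ActsAsPow

variable {K L : Type*} [Field K] [Field L] [Algebra K L] {m m' : ℕ} {σ τ : L ≃ₐ[K] L} {a b : ℤ}

theorem one : ActsAsPow m (1 : L ≃ₐ[K] L) 1 := fun ζ _ => (zpow_one ζ).symm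

theorem mul (hσ : ActsAsPow m σ a) (hτ : ActsAsPow m τ b) : ActsAsPow m (σ * τ) (a * b) := by
  intro ζ hζ
  rw [AlgEquiv.mul_apply, hτ ζ hζ, map_zpow₀, hσ ζ hζ, zpow_mul]

theorem pow (hσ : ActsAsPow m σ a) (k : ℕ) : ActsAsPow m (σ ^ k) (a ^ k) := by
  induction k with
  | zero => rw [pow_zero, pow_zero]; exact one
  | succ k ih => rw [pow_succ, pow_succ]; exact ih.mul hσ

theorem congr (hσ : ActsAsPow m σ a) (hm : m ≠ 0) (h : a ≡ b [ZMOD m]) : ActsAsPow m σ b :=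
  fun ζ hζ => (hσ ζ hζ).trans (zpow_eq_zpow_of_modEq hm hζ h)

theorem of_dvd (hσ : ActsAsPow m σ a) (h : m' ∣ m) : ActsAsPow m' σ a := by
  obtain ⟨c, rfl⟩ := h
  intro ζ hζ
  exact hσ ζ (by rw [pow_mul, hζ, one_pow])

theorem inv_of_modEq (hσ : ActsAsPow m σ a) (hm : m ≠ 0) (h : a * b ≡ 1 [ZMOD m]) :
    ActsAsPow m σ⁻¹ b := by
  intro ζ hζ
  have h1 : σ (ζ ^ b) = ζ := by
    rw [map_zpow₀, hσ ζ hζ, ← zpow_mul, zpow_eq_zpow_of_modEq hm hζ h, zpow_one]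
  nth_rewrite 1 [← h1]
  exact σ.symm_apply_apply _

theorem inv_mul (hσ : ActsAsPow m σ a) (hτ : ActsAsPow m τ a) : ActsAsPow m (σ⁻¹ * τ) 1 := by
  intro ζ hζ
  rw [AlgEquiv.mul_apply, hτ ζ hζ, ← hσ ζ hζ, zpow_one]
  exact σ.symm_apply_apply _

theorem modEq (hσ : ActsAsPow m σ a) (hσ' : ActsAsPow m σ b) (hm : m ≠ 0) {ζ : L}
    (hζ : IsPrimitiveRoot ζ m) : a ≡ b [ZMOD m] := by
  have hζ0 : ζ ≠ 0 := hζ.ne_zero hm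
  have h1 : ζ ^ (b - a) = 1 := by
    rw [zpow_sub₀ hζ0, ← hσ ζ hζ.pow_eq_one, ← hσ' ζ hζ.pow_eq_one, div_self]
    simpa using hζ0
  exact Int.modEq_iff_dvd.2 ((hζ.zpow_eq_one_iff_dvd _).1 h1)

theorem exists_int (hm : m ≠ 0) (σ : L ≃ₐ[K] L) : ∃ a : ℤ, ActsAsPow m σ a := by
  have : NeZero m := ⟨hm⟩
  obtain ⟨a, ha⟩ := rootsOfUnity.integer_power_of_ringEquiv' m (σ : L ≃+* L)
  refine ⟨a, fun ζ hζ => ?_⟩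
  have hu : IsUnit ζ := IsUnit.of_pow_eq_one hζ hm
  have := ha hu.unit (by rw [mem_rootsOfUnity]; ext; simpa using hζ)
  simpa using this

end ActsAsPow

theorem one_add_pow_modEq {d u : ℤ} (hdu : d ∣ u) (z : ℤ) (m : ℕ) :
    (1 + u * z) ^ m ≡ 1 + u * (m * z) [ZMOD u * d] := by
  obtain ⟨k, hk⟩ := Polynomial.powAddExpansion (1 : ℤ) (u * z) m
  obtain ⟨c, rfl⟩ := hdu
  rw [hk]
  refine (Int.modEq_iff_dvd.2 ⟨-(k * c * z ^ 2), ?_⟩)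
  simp only [one_pow]
  ring

/-- The exponent starts at 2 so that the quadratic term, a multiple of d^(2n+4), vanishes modulo
d^(n+4) for every d, including d = 2. -/
theorem one_add_pow_self_modEq (d n : ℕ) (w : ℤ) :
    (1 + (d : ℤ) ^ (n + 2) * w) ^ d ≡ 1 + (d : ℤ) ^ (n + 3) * w [ZMOD (d : ℤ) ^ (n + 4)] := by
  obtain ⟨k, hk⟩ := Polynomial.powAddExpansion (1 : ℤ) ((d : ℤ) ^ (n + 2) * w) d
  rw [hk]
  refine (Int.modEq_iff_dvd.2 ⟨-(k * d ^ n * w ^ 2), ?_⟩)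
  simp only [one_pow]
  ring

/-! ### Topological generators of the cyclotomic Galois group -/

section TopologicallyFG

variable {K L : Type*} [Field K] [Field L] [Algebra K L] {d : ℕ}

/-- The d-th power moves the digit x up one level; the ambiguity of x modulo d is pushed into
multiples of d^(n+4). -/
theorem ActsAsPow.pow_self (hd : d ≠ 0) (hprim : ∀ n, ∃ ζ : L, IsPrimitiveRoot ζ (d ^ n))
    {σ : L ≃ₐ[K] L} {n : ℕ} {x : ℤ} (h : ActsAsPow (d ^ (n + 3)) σ (1 + (d : ℤ) ^ (n + 2) * x)) :
    ActsAsPow (d ^ (n + 4)) (σ ^ d) (1 + (d : ℤ) ^ (n + 3) * x) := by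
  obtain ⟨a, ha⟩ := ActsAsPow.exists_int (pow_ne_zero (n + 4) hd) σ
  obtain ⟨ζ, hζ⟩ := hprim (n + 3)
  obtain ⟨y, hy⟩ := (h.modEq (ha.of_dvd (pow_dvd_pow d (Nat.le_succ (n + 3))))
    (pow_ne_zero _ hd) hζ).dvd
  have ha' : a = 1 + (d : ℤ) ^ (n + 2) * (x + d * y) := by
    push_cast at hy
    linear_combination hy
  refine (ha.pow d).congr (pow_ne_zero _ hd) ?_
  rw [ha']
  push_cast
  refine (one_add_pow_self_modEq d n _).trans (Int.modEq_iff_dvd.2 ⟨-y, ?_⟩)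
  ring

theorem ActsAsPow.pow_pow (hd : d ≠ 0) (hprim : ∀ n, ∃ ζ : L, IsPrimitiveRoot ζ (d ^ n))
    {σ : L ≃ₐ[K] L} {n : ℕ} {x : ℤ} (h : ActsAsPow (d ^ (n + 3)) σ (1 + (d : ℤ) ^ (n + 2) * x))
    (k : ℕ) : ActsAsPow (d ^ (n + k + 3)) (σ ^ d ^ k) (1 + (d : ℤ) ^ (n + k + 2) * x) := by
  induction k with
  | zero => simpa using h
  | succ k ih =>
    rw [pow_succ d k, pow_mul]
    exact ih.pow_self hd hprim

variable (K L) in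
/-- The group of all `x` such that `1 + d ^ (n + 2) * x` modulo `d ^ (n + 3)` is a value of the
cyclotomic character. -/
def cyclotomicDigits (hd : d ≠ 0) (n : ℕ) : AddSubgroup ℤ where
  carrier := {x | ∃ σ : L ≃ₐ[K] L, ActsAsPow (d ^ (n + 3)) σ (1 + (d : ℤ) ^ (n + 2) * x)}
  zero_mem' := ⟨1, by simpa using ActsAsPow.one⟩
  add_mem' := by
    rintro x y ⟨σ, hσ⟩ ⟨τ, hτ⟩
    refine ⟨σ * τ, (hσ.mul hτ).congr (pow_ne_zero _ hd)
      (Int.modEq_iff_dvd.2 ⟨-(d ^ (n + 1) * x * y), ?_⟩)⟩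
    push_cast
    ring
  neg_mem' := by
    rintro x ⟨σ, hσ⟩
    refine ⟨σ⁻¹, hσ.inv_of_modEq (pow_ne_zero _ hd)
      (Int.modEq_iff_dvd.2 ⟨d ^ (n + 1) * x * x, ?_⟩)⟩
    push_cast
    ring

theorem exists_cyclotomicDigits_eq (hd : d ≠ 0)
    (hprim : ∀ n, ∃ ζ : L, IsPrimitiveRoot ζ (d ^ n)) :
    ∃ N, ∀ k, cyclotomicDigits K L hd N = cyclotomicDigits K L hd (N + k) := by
  -- If σ has digit x at one level, σ^d has digit x at the next; ℤ is Noetherian.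
  have hmono : Monotone fun n => (cyclotomicDigits K L hd n).toIntSubmodule :=
    monotone_nat_of_le_succ fun n x ⟨σ, hσ⟩ => ⟨σ ^ d, hσ.pow_self hd hprim⟩
  obtain ⟨N, hN⟩ := monotone_stabilizes_iff_noetherian.2
    (inferInstance : IsNoetherian ℤ ℤ) ⟨_, hmono⟩
  exact ⟨N, fun k => AddSubgroup.toIntSubmodule.injective (hN (N + k) (Nat.le_add_right N k))⟩

/-- Some element topologically generates a congruence subgroup. -/
theorem exists_pow_mul_actsAsPow_one (hd : d ≠ 0)
    (hprim : ∀ n, ∃ ζ : L, IsPrimitiveRoot ζ (d ^ n)) :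
    ∃ (N : ℕ) (σ : L ≃ₐ[K] L), ∀ τ : L ≃ₐ[K] L, ActsAsPow (d ^ (N + 2)) τ 1 →
      ∀ k : ℕ, ∃ i : ℕ, ActsAsPow (d ^ (N + k + 2)) (σ ^ i * τ) 1 := by
  obtain ⟨N, hN⟩ := exists_cyclotomicDigits_eq (K := K) hd hprim
  obtain ⟨z, hz⟩ := Int.subgroup_cyclic (cyclotomicDigits K L hd N)
  obtain ⟨σ, hσ⟩ : z ∈ cyclotomicDigits K L hd N := by
    rw [hz]
    exact AddSubgroup.subset_closure rfl
  refine ⟨N, σ, fun τ hτ k => ?_⟩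
  induction k with
  | zero => exact ⟨0, by simpa using hτ⟩
  | succ k ih =>
    obtain ⟨i, hi⟩ := ih
    set ρ := σ ^ i * τ
    obtain ⟨a, ha⟩ := ActsAsPow.exists_int (pow_ne_zero (N + k + 3) hd) ρ
    obtain ⟨ζ, hζ⟩ := hprim (N + k + 2)
    obtain ⟨x, hx⟩ := (hi.modEq (ha.of_dvd (pow_dvd_pow d (Nat.le_succ (N + k + 2))))
      (pow_ne_zero _ hd) hζ).dvd
    obtain rfl : a = 1 + (d : ℤ) ^ (N + k + 2) * x := by
      push_cast at hx
      linear_combination hx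
    have hxmem : x ∈ cyclotomicDigits K L hd N := by
      rw [hN k]
      exact ⟨ρ, ha⟩
    rw [hz, AddSubgroup.mem_closure_singleton] at hxmem
    obtain ⟨w, rfl⟩ := hxmem
    have hd0 : (d : ℤ) ≠ 0 := by exact_mod_cast hd
    -- The digit of ρ is wz and that of σ^(d^k) is z, so the power e ≡ -w modulo d cancels it.
    obtain ⟨e, he⟩ : ∃ e : ℕ, (e : ℤ) ≡ -w [ZMOD d] :=
      ⟨((-w) % d).toNat, by rw [Int.toNat_of_nonneg (Int.emod_nonneg _ hd0)]; exact Int.mod_modEq _ _⟩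
    obtain ⟨c, hc⟩ := he.dvd
    have h1 := ((hσ.pow_pow hd hprim k).pow e).congr (pow_ne_zero _ hd)
      (b := 1 + (d : ℤ) ^ (N + k + 2) * (e * z)) (by
        push_cast
        rw [pow_succ (d : ℤ) (N + k + 2)]
        exact one_add_pow_modEq (dvd_pow_self _ (by omega)) z e)
    refine ⟨d ^ k * e + i, ?_⟩
    rw [pow_add σ, pow_mul σ, mul_assoc]
    refine (h1.mul ha).congr (pow_ne_zero _ hd) (Int.modEq_iff_dvd.2
      ⟨z * c - d ^ (N + k + 1) * (e * z) * (w * z), ?_⟩)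
    have hw : w = -(e : ℤ) - d * c := by linear_combination -hc
    rw [smul_eq_mul, hw]
    push_cast
    ring

/-- The automorphisms trivial on d^(N+2)-th roots of unity have finite index, so one representative
per realised residue is adjoined to σ. -/
theorem exists_finset_actsAsPow_one (hd : d ≠ 0)
    (hprim : ∀ n, ∃ ζ : L, IsPrimitiveRoot ζ (d ^ n)) :
    ∃ S : Finset (L ≃ₐ[K] L), ∀ (τ : L ≃ₐ[K] L) (n : ℕ),
      ∃ h ∈ Subgroup.closure (S : Set (L ≃ₐ[K] L)), ActsAsPow (d ^ n) (h⁻¹ * τ) 1 := by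
  classical
  obtain ⟨N, σ, hσ⟩ := exists_pow_mul_actsAsPow_one (K := K) hd hprim
  set m := d ^ (N + 2) with hmdef
  have hm : m ≠ 0 := pow_ne_zero _ hd
  -- Residues that are not values of the character receive the harmless default 1.
  have hex : ∀ r : ℕ, ∃ g : L ≃ₐ[K] L, (∃ g', ActsAsPow (K := K) (L := L) m g' r) →
      ActsAsPow m g r := fun r => by
    by_cases h : ∃ g', ActsAsPow (K := K) (L := L) m g' r
    · exact ⟨h.choose, fun _ => h.choose_spec⟩
    · exact ⟨1, fun h' => absurd h' h⟩
  choose g hg using hex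
  refine ⟨insert σ ((Finset.range m).image g), fun τ n => ?_⟩
  have hm0 : (m : ℤ) ≠ 0 := by exact_mod_cast hm
  obtain ⟨a, ha⟩ := ActsAsPow.exists_int hm τ
  set r : ℕ := (a % m).toNat with hr
  have hrz : (r : ℤ) = a % m := Int.toNat_of_nonneg (Int.emod_nonneg _ hm0)
  have hrm : r < m := by
    have := Int.emod_lt_of_pos a (show (0 : ℤ) < m by positivity)
    omega
  have hτr : ActsAsPow m τ r := ha.congr hm (by rw [hrz]; exact (Int.mod_modEq _ _).symm)
  obtain ⟨i, hi⟩ := hσ _ ((hg r ⟨τ, hτr⟩).inv_mul hτr) n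
  refine ⟨g r * (σ ^ i)⁻¹, mul_mem (Subgroup.subset_closure ?_)
    (inv_mem (pow_mem (Subgroup.subset_closure ?_) i)), ?_⟩
  · simpa using Or.inr ⟨r, hrm, rfl⟩
  · simp
  · rw [mul_inv_rev, inv_inv, mul_assoc]
    exact hi.of_dvd (pow_dvd_pow d (by omega))

/-- Finitely many elements generate E, and each is a polynomial in roots of unity of bounded level.
-/
theorem exists_mem_fixingSubgroup_of_actsAsPow_one
    [hcyc : IsCyclotomicExtension (Set.range fun n : ℕ => d ^ n) K L] (E : IntermediateField K L)
    [FiniteDimensional K E] :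
    ∃ n, ∀ η : L ≃ₐ[K] L, ActsAsPow (d ^ n) η 1 → η ∈ E.fixingSubgroup := by
  have hpt : ∀ x : L, ∃ n, ∀ m, n ≤ m → ∀ η : L ≃ₐ[K] L, ActsAsPow (d ^ m) η 1 → η x = x := by
    intro x
    refine Algebra.adjoin_induction
      (p := fun x _ => ∃ n, ∀ m, n ≤ m → ∀ η : L ≃ₐ[K] L, ActsAsPow (d ^ m) η 1 → η x = x)
      ?_ ?_ ?_ ?_ (hcyc.adjoin_roots x)
    · rintro ζ ⟨_, ⟨n, rfl⟩, -, hζ⟩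
      refine ⟨n, fun m hnm η hη => ?_⟩
      simpa using (hη.of_dvd (pow_dvd_pow d hnm)) ζ hζ
    · exact fun r => ⟨0, fun _ _ η _ => η.commutes r⟩
    · rintro x y _ _ ⟨n, hn⟩ ⟨n', hn'⟩
      refine ⟨max n n', fun m hm η hη => ?_⟩
      rw [map_add, hn m (le_of_max_le_left hm) η hη, hn' m (le_of_max_le_right hm) η hη]
    · rintro x y _ _ ⟨n, hn⟩ ⟨n', hn'⟩
      refine ⟨max n n', fun m hm η hη => ?_⟩
      rw [map_mul, hn m (le_of_max_le_left hm) η hη, hn' m (le_of_max_le_right hm) η hη]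
  choose n hn using hpt
  obtain ⟨T, hT⟩ := E.essFiniteType_iff.1 inferInstance
  refine ⟨T.sup n, fun η hη => ?_⟩
  have hle : E ≤ IntermediateField.fixedField (Subgroup.zpowers η) := by
    rw [← hT, IntermediateField.adjoin_le_iff]
    intro x hx
    have hst : Subgroup.zpowers η ≤ MulAction.stabilizer (L ≃ₐ[K] L) x := by
      rw [Subgroup.zpowers_le]
      exact hn x _ (Finset.le_sup (f := n) hx) η hη
    exact fun g => hst g.2
  exact (IntermediateField.le_iff_le _ _).1 hle (Subgroup.mem_zpowers η)

/-- The Galois group of a pro-`d` cyclotomic extension is topologically finitely generated. -/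
theorem isTopologicallyFG_of_isCyclotomicExtension (hd : d ≠ 0)
    [hcyc : IsCyclotomicExtension (Set.range fun n : ℕ => d ^ n) K L] :
    IsTopologicallyFG (L ≃ₐ[K] L) := by
  obtain ⟨S, hS⟩ := exists_finset_actsAsPow_one (K := K) (L := L) hd
    fun n => hcyc.exists_isPrimitiveRoot ⟨n, rfl⟩ (pow_ne_zero n hd)
  refine ⟨S, eq_top_iff.2 fun τ _ => ?_⟩
  refine mem_closure_iff_nhds.2 fun U hU => ?_
  have hV : (fun g : L ≃ₐ[K] L => τ * g) ⁻¹' U ∈ nhds 1 :=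
    (continuous_const_mul τ).continuousAt.preimage_mem_nhds (by simpa using hU)
  obtain ⟨E, hE, hEV⟩ := (krullTopology_mem_nhds_one_iff K L _).1 hV
  obtain ⟨n, hn⟩ := exists_mem_fixingSubgroup_of_actsAsPow_one (d := d) E
  obtain ⟨h, hh, hact⟩ := hS τ n
  have := hEV (inv_mem (hn _ hact))
  exact ⟨h, by simpa using this, hh⟩

end TopologicallyFG

/-! ### Passage to quotients and smallness -/

theorem IsTopologicallyFG.of_surjective {G H : Type*} [Group G] [TopologicalSpace G]
    [IsTopologicalGroup G] [Group H] [TopologicalSpace H] [IsTopologicalGroup H] (φ : G →* H)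
    (hφ : Continuous φ) (hsurj : Function.Surjective φ) (hG : IsTopologicallyFG G) :
    IsTopologicallyFG H := by
  classical
  obtain ⟨S, hS⟩ := hG
  refine ⟨S.image φ, eq_top_iff.2 fun h _ => ?_⟩
  obtain ⟨g, rfl⟩ := hsurj h
  have hg : g ∈ closure (Subgroup.closure (S : Set G) : Set G) := by
    have : g ∈ (Subgroup.closure (S : Set G)).topologicalClosure := by rw [hS]; trivial
    exact this
  have := image_closure_subset_closure_image hφ (Set.mem_image_of_mem φ hg)
  rwa [← Subgroup.coe_map, MonoidHom.map_closure, ← Finset.coe_image] at this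

theorem AlgEquiv.restrictNormalHom_continuous_of_tower (K M L : Type*) [Field K] [Field M]
    [Field L] [Algebra K M] [Algebra K L] [Algebra M L] [IsScalarTower K M L] [Normal K M] :
    Continuous (AlgEquiv.restrictNormalHom (F := K) (K₁ := L) M) := by
  refine continuous_of_continuousAt_one _ ?_
  rw [ContinuousAt, map_one, Filter.tendsto_def]
  intro U hU
  obtain ⟨E, hE, hEU⟩ := (krullTopology_mem_nhds_one_iff K M _).1 hU
  have hfin : FiniteDimensional K (E.map (IsScalarTower.toAlgHom K M L)) :=
    (E.equivMap (IsScalarTower.toAlgHom K M L)).toLinearEquiv.finiteDimensional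
  refine (krullTopology_mem_nhds_one_iff K L _).2
    ⟨E.map (IsScalarTower.toAlgHom K M L), hfin, fun σ hσ => hEU ?_⟩
  rw [SetLike.mem_coe, IntermediateField.mem_fixingSubgroup_iff] at hσ ⊢
  intro x hx
  apply (algebraMap M L).injective
  exact (AlgEquiv.restrictNormal_commutes σ M x).trans (hσ _ ⟨x, hx, rfl⟩)

theorem IsTopologicallyFG.of_algHom {K M L : Type*} [Field K] [Field M] [Field L] [Algebra K M]
    [Algebra K L] [Normal K M] [Normal K L] (i : M →ₐ[K] L) (h : IsTopologicallyFG (L ≃ₐ[K] L)) :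
    IsTopologicallyFG (M ≃ₐ[K] M) := by
  let : Algebra M L := i.toRingHom.toAlgebra
  have : IsScalarTower K M L := .of_algebraMap_eq fun x => (i.commutes x).symm
  exact h.of_surjective _ (AlgEquiv.restrictNormalHom_continuous_of_tower K M L)
    (AlgEquiv.restrictNormalHom_surjective L)

/-- Subgroups of index n contain the closed subgroup R = G^n. In G/R the image W of the dense
subgroup is finitely generated, abelian and torsion, hence finite, hence closed, hence everything.
-/
theorem IsTopologicallyFG.finite_setOf_index_eq {G : Type*} [CommGroup G] [TopologicalSpace G]
    [IsTopologicalGroup G] [CompactSpace G] [T2Space G] (hG : IsTopologicallyFG G) {n : ℕ}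
    (hn : 0 < n) : {H : Subgroup G | H.index = n}.Finite := by
  obtain ⟨S, hS⟩ := hG
  set R : Subgroup G := (powMonoidHom n : G →* G).range with hR
  have hRclosed : IsClosed (R : Set G) := by
    rw [hR, MonoidHom.coe_range]
    exact (isCompact_range (continuous_pow n)).isClosed
  set W : Subgroup (G ⧸ R) := (Subgroup.closure (S : Set G)).map (QuotientGroup.mk' R) with hW
  have hpow : ∀ q : G ⧸ R, q ^ n = 1 := by
    intro q
    obtain ⟨g, rfl⟩ := QuotientGroup.mk'_surjective R q
    rw [← map_pow]
    exact (QuotientGroup.eq_one_iff _).2 ⟨g, rfl⟩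
  have hWfin : Finite W := by
    have : Group.FG W := by
      rw [Group.fg_iff_subgroup_fg, hW, MonoidHom.map_closure]
      classical
      exact ⟨S.image (QuotientGroup.mk' R), by rw [Finset.coe_image]⟩
    refine CommGroup.finite_of_fg_isMulTorsion W fun w => isOfFinOrder_iff_pow_eq_one.2 ⟨n, hn, ?_⟩
    ext
    simpa using hpow w
  have hWtop : W = ⊤ := by
    have hcl : IsClosed ((QuotientGroup.mk' R) ⁻¹' (W : Set (G ⧸ R))) :=
      (Set.toFinite (W : Set (G ⧸ R))).isClosed.preimage QuotientGroup.continuous_mk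
    have hle : (Subgroup.closure (S : Set G)).topologicalClosure ≤ W.comap (QuotientGroup.mk' R) :=
      Subgroup.topologicalClosure_minimal _ (Subgroup.le_comap_map _ _) hcl
    rw [hS] at hle
    refine eq_top_iff.2 fun q _ => ?_
    obtain ⟨g, rfl⟩ := QuotientGroup.mk'_surjective R q
    exact hle trivial
  have : Finite (G ⧸ R) := by
    rw [hWtop] at hWfin
    exact Finite.of_equiv _ Subgroup.topEquiv.toEquiv
  refine (Set.finite_range fun V : Subgroup (G ⧸ R) => V.comap (QuotientGroup.mk' R)).subset ?_
  rintro H rfl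
  refine ⟨H.map (QuotientGroup.mk' R), Subgroup.comap_map_eq_self ?_⟩
  rw [QuotientGroup.ker_mk']
  rintro _ ⟨g, rfl⟩
  exact H.pow_index_mem g

open scoped IsMulCommutative in
theorem IsAbelianGalois.isSmallExtension {K L : Type*} [Field K] [Field L] [Algebra K L]
    [IsAbelianGalois K L] (h : IsTopologicallyFG (L ≃ₐ[K] L)) : IsSmallExtension K L where
  isGalois := inferInstance
  finite_index_eq _ hn := h.finite_setOf_index_eq hn

theorem mainTheorem12 {K : Type*} [Field K] (f : K[X])
    (hf : (f.natDegree : K) ≠ 0) :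
    IsSmallExtension K (constantField f) ∧
      constantField f ≤ proCyclotomicField K (SepClosureRatFunc K) f.natDegree ∧
      IsTopologicallyFG (constantField f ≃ₐ[K] constantField f) := by
  have hle := constantField_le_proCyclotomicField f hf
  have hd0 : f.natDegree ≠ 0 := by intro h; simp [h] at hf
  set P := proCyclotomicField K (SepClosureRatFunc K) f.natDegree with hP
  have hcyc := isCyclotomicExtension_proCyclotomicField K (SepClosureRatFunc K) hf
  rw [← hP] at hcyc
  have hab : IsAbelianGalois K P :=
    IsCyclotomicExtension.isAbelianGalois (Set.range fun n : ℕ => f.natDegree ^ n) K P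
  have hab' : IsAbelianGalois K (constantField f) :=
    .of_algHom (IntermediateField.inclusion hle)
  have hfg : IsTopologicallyFG (constantField f ≃ₐ[K] constantField f) :=
    (isTopologicallyFG_of_isCyclotomicExtension (K := K) (L := P) hd0).of_algHom
      (IntermediateField.inclusion hle)
  exact ⟨hab'.isSmallExtension hfg, hle, hfg⟩
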